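/- Let $\mathcal{W}=W(2,2)$ be the complex Lie algebra with basis $\{L_n, W_n, z \mid n\in\mathbb{Z}\}$ and brackets $$[L_n,L_m]=(m-n)L_{m+n}+\tfrac{n^3-n}{12}\delta_{m+n,0}\,z,\qquad [L_n,W_m]=(m-n)W_{m+n}+\tfrac{n^3-n}{12}\delta_{m+n,0}\,z,$$ $$[W_n,W_m]=[z,W_m]=[z,L_m]=0,$$ and let $\mathcal{W}_+$ be the subalgebra spanned by the $L_n, W_n$ with $n>0$. Let $S(z)$ be the algebra of polynomials in $z$ with complex coefficients, viewed as a subalgebra of the universal enveloping algebra of $\mathcal{W}$. Let $\varphi:\mathcal{W}_+\to\mathbb{C}$ be a non-singular Lie algebra homomorphism, i.e. $\varphi(L_i)\varphi(W_i)\neq 0$ for $i=1,2$. A vector $v$ of a $\mathcal{W}$-module is called a Whittaker vector (of type $\varphi$) if $xv=\varphi(x)v$ for all $x\in\mathcal{W}_+$; the zero vector is included. A $\mathcal{W}$-module $V$ is a Whittaker module of type $\varphi$ with cyclic Whittaker vector $w$ if $w\in V$ is a Whittaker vector of type $\varphi$ that generates $V$ as a $\mathcal{W}$-module. Suppose that $V$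 is a Whittaker module of type $\varphi$ with cyclic Whittaker vector $w$, and that $V$ is indecomposable, i.e. $V$ is nonzero and is not the direct sum of two nonzero submodules. Then the set $Wh(V)$ of all Whittaker vectors of type $\varphi$ in $V$ (including $0$) equals $S(z)w=\{p(z)w \mid p(z)\in S(z)\}$. -/

import Mathlib

noncomputable section

namespace WAlgebra22

/-- Labels of the standard basis `{L_n, W_n, z | n ∈ ℤ}` of the algebra `W(2,2)`. -/
inductive Gen : Type
  | L (n : ℤ)
  | W (n : ℤ)
  | z

/-- The complex vector space with basis `{L_n, W_n, z | n ∈ ℤ}`. It carries the Lie algebra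
structure of `W(2,2)` below. -/
def W22 : Type := Gen →₀ ℂ

instance : AddCommGroup W22 := inferInstanceAs (AddCommGroup (Gen →₀ ℂ))

instance : Module ℂ W22 := inferInstanceAs (Module ℂ (Gen →₀ ℂ))

/-- The standard basis of `W(2,2)`. -/
def basis : Module.Basis Gen ℂ W22 := Module.Basis.ofRepr (LinearEquiv.refl ℂ (Gen →₀ ℂ))

/-- The basis element `L_n`. -/
def L (n : ℤ) : W22 := basis (Gen.L n)

/-- The basis element `W_n`. -/
def W (n : ℤ) : W22 := basis (Gen.W n)

/-- The central basis element `z`. -/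
def z : W22 := basis Gen.z

/-- The scalar `(n³ - n)/12 · δ_{m+n,0}`. -/
def cocycle (n m : ℤ) : ℂ := if m + n = 0 then ((n : ℂ) ^ 3 - (n : ℂ)) / 12 else 0

/-- The brackets of the basis elements:
`[L_n, L_m] = (m - n) L_{m+n} + (n³ - n)/12 δ_{m+n,0} z`,
`[L_n, W_m] = (m - n) W_{m+n} + (n³ - n)/12 δ_{m+n,0} z`, the antisymmetric counterpart
`[W_n, L_m] = -[L_m, W_n]`, and all other brackets are zero. -/
def genBracket : Gen → Gen → W22
  | Gen.L n, Gen.L m => ((m : ℂ) - (n : ℂ)) • L (m + n) + cocycle n m • z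
  | Gen.L n, Gen.W m => ((m : ℂ) - (n : ℂ)) • W (m + n) + cocycle n m • z
  | Gen.W n, Gen.L m => -(((n : ℂ) - (m : ℂ)) • W (n + m) + cocycle m n • z)
  | _, _ => 0

/-- The bilinear extension of `genBracket`. -/
def bracketBilin : W22 →ₗ[ℂ] W22 →ₗ[ℂ] W22 :=
  basis.constr ℂ fun a => basis.constr ℂ fun b => genBracket a b

instance : Bracket W22 W22 := ⟨fun x y => bracketBilin x y⟩

theorem bracket_def (x y : W22) : ⁅x, y⁆ = bracketBilin x y := rfl

theorem bracketBilin_basis (a b : Gen) : bracketBilin (basis a) (basis b) = genBracket a b := by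
  simp [bracketBilin]

theorem cocycle_skew (n m : ℤ) : cocycle n m = -cocycle m n := by
  unfold cocycle
  by_cases h : m + n = 0
  · obtain rfl : m = -n := by omega
    simp
    ring
  · have h' : ¬ n + m = 0 := by omega
    simp [h, h']

theorem genBracket_skew (a b : Gen) : genBracket a b = -genBracket b a := by
  rcases a with n | n | _ <;> rcases b with m | m | _ <;> simp [genBracket]
  rw [cocycle_skew n m, add_comm m n]
  module

theorem bracketBilin_skew (x y : W22) : bracketBilin x y = -bracketBilin y x := by
  have h : bracketBilin = -bracketBilin.flip := by
    refine basis.ext fun a => basis.ext fun b => ?_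
    simp only [LinearMap.neg_apply, LinearMap.flip_apply, bracketBilin_basis]
    exact genBracket_skew a b
  exact congrArg (fun f : W22 →ₗ[ℂ] W22 →ₗ[ℂ] W22 => f x y) h

theorem bracketBilin_L_L (n m : ℤ) :
    bracketBilin (L n) (L m) = ((m : ℂ) - (n : ℂ)) • L (m + n) + cocycle n m • z :=
  bracketBilin_basis _ _

theorem bracketBilin_L_W (n m : ℤ) :
    bracketBilin (L n) (W m) = ((m : ℂ) - (n : ℂ)) • W (m + n) + cocycle n m • z :=
  bracketBilin_basis _ _

theorem bracketBilin_W_L (n m : ℤ) :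
    bracketBilin (W n) (L m) = -(((n : ℂ) - (m : ℂ)) • W (n + m) + cocycle m n • z) :=
  bracketBilin_basis _ _

theorem bracketBilin_W_W (n m : ℤ) : bracketBilin (W n) (W m) = 0 := bracketBilin_basis _ _

theorem bracketBilin_z_left (x : W22) : bracketBilin z x = 0 := by
  have h : bracketBilin z = 0 :=
    basis.ext fun b => (bracketBilin_basis Gen.z b).trans (by cases b <;> rfl)
  rw [h, LinearMap.zero_apply]

theorem bracketBilin_z_right (x : W22) : bracketBilin x z = 0 := by
  rw [bracketBilin_skew, bracketBilin_z_left, neg_zero]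

theorem cocycle_jacobi (n m k : ℤ) :
    ((k : ℂ) - m) * cocycle n (k + m) =
      ((m : ℂ) - n) * cocycle (m + n) k + ((k : ℂ) - n) * cocycle m (k + n) := by
  unfold cocycle
  by_cases h : k + m + n = 0
  · obtain rfl : k = -m - n := by omega
    rw [if_pos (by omega), if_pos (by omega), if_pos (by omega)]
    push_cast
    ring
  · rw [if_neg (by omega), if_neg (by omega), if_neg (by omega)]
    simp

theorem jacobi_basis (a b c : Gen) :
    bracketBilin (basis a) (bracketBilin (basis b) (basis c)) =
      bracketBilin (bracketBilin (basis a) (basis b)) (basis c) +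
        bracketBilin (basis b) (bracketBilin (basis a) (basis c)) := by
  have hL : ∀ n, basis (Gen.L n) = L n := fun _ => rfl
  have hW : ∀ n, basis (Gen.W n) = W n := fun _ => rfl
  have hz : basis Gen.z = z := rfl
  rcases a with n | n | _ <;> rcases b with m | m | _ <;> rcases c with k | k | _ <;>
    simp only [hL, hW, hz, bracketBilin_L_L, bracketBilin_L_W, bracketBilin_W_L, bracketBilin_W_W,
      bracketBilin_z_left, bracketBilin_z_right, map_add, map_smul, map_neg, map_zero,
      LinearMap.add_apply, LinearMap.smul_apply, LinearMap.neg_apply, LinearMap.zero_apply,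
      smul_zero, add_zero, neg_zero, smul_neg]
  · rw [show k + (m + n) = k + m + n by ring, show k + n + m = k + m + n by ring]
    have h := congrArg (fun c : ℂ => c • z) (cocycle_jacobi n m k)
    push_cast
    linear_combination (norm := module) h
  · rw [show k + (m + n) = k + m + n by ring, show k + n + m = k + m + n by ring]
    have h := congrArg (fun c : ℂ => c • z) (cocycle_jacobi n m k)
    push_cast
    linear_combination (norm := module) h
  · rw [show m + n + k = m + k + n by ring, show m + (k + n) = m + k + n by ring,
      cocycle_skew k (m + n), cocycle_skew (k + n) m, add_comm m k]
    have h := congrArg (fun c : ℂ => c • z) (cocycle_jacobi n m k)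
    push_cast
    linear_combination (norm := module) h
  · rw [show n + (k + m) = n + m + k by ring, show n + k + m = n + m + k by ring,
      cocycle_skew (k + m) n, cocycle_skew k (n + m), add_comm n m, add_comm n k]
    have h := congrArg (fun c : ℂ => c • z) (cocycle_jacobi n m k)
    push_cast
    linear_combination (norm := module) h

instance : LieRing W22 where
  add_lie x y t := by simp only [bracket_def, map_add, LinearMap.add_apply]
  lie_add x y t := by simp only [bracket_def, map_add]
  lie_self x := by
    have h : bracketBilin x x = -bracketBilin x x := bracketBilin_skew x x
    have h2 : (2 : ℂ) • bracketBilin x x = 0 := by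
      rw [two_smul]
      exact eq_neg_iff_add_eq_zero.mp h
    exact (smul_eq_zero.mp h2).resolve_left two_ne_zero
  leibniz_lie x y t := by
    let T : W22 →ₗ[ℂ] W22 →ₗ[ℂ] W22 →ₗ[ℂ] W22 :=
      LinearMap.mk₂ ℂ (fun a b => bracketBilin a ∘ₗ bracketBilin b - bracketBilin (bracketBilin a b)
          - bracketBilin b ∘ₗ bracketBilin a)
        (by intros; ext; simp; abel)
        (by intros; ext; simp [smul_sub])
        (by intros; ext; simp; abel)
        (by intros; ext; simp [smul_sub])
    have hT : T = 0 := by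
      refine basis.ext fun a => basis.ext fun b => basis.ext fun c => ?_
      simp [T, jacobi_basis a b c]
    have h : T x y t = 0 := by simp [hT]
    simp only [T, LinearMap.mk₂_apply, LinearMap.sub_apply, LinearMap.comp_apply] at h
    simp only [bracket_def]
    linear_combination (norm := abel) h

instance : LieAlgebra ℂ W22 where
  lie_smul c x y := by simp only [bracket_def, map_smul]

/-- The subalgebra `𝒲₊` of `W(2,2)` spanned by the `L_n` and `W_n` with `n > 0`. -/
def Wplus : LieSubalgebra ℂ W22 where
  toSubmodule := Submodule.span ℂ {x | ∃ n : ℤ, 0 < n ∧ (x = L n ∨ x = W n)}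
  lie_mem' := by
    intro x y hx hy
    set S : Set W22 := {x | ∃ n : ℤ, 0 < n ∧ (x = L n ∨ x = W n)} with hS
    have hLm : ∀ n : ℤ, 0 < n → L n ∈ Submodule.span ℂ S := fun n hn =>
      Submodule.subset_span ⟨n, hn, Or.inl rfl⟩
    have hWm : ∀ n : ℤ, 0 < n → W n ∈ Submodule.span ℂ S := fun n hn =>
      Submodule.subset_span ⟨n, hn, Or.inr rfl⟩
    have hc : ∀ n m : ℤ, 0 < n → 0 < m → cocycle n m = 0 := fun n m hn hm =>
      if_neg (by omega)
    change bracketBilin x y ∈ Submodule.span ℂ S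
    refine Submodule.span_induction₂ (p := fun x y _ _ => bracketBilin x y ∈ Submodule.span ℂ S)
      ?_ ?_ ?_ ?_ ?_ ?_ ?_ hx hy
    · rintro a b ⟨n, hn, rfl | rfl⟩ ⟨m, hm, rfl | rfl⟩
      · rw [bracketBilin_L_L, hc n m hn hm, zero_smul, add_zero]
        exact Submodule.smul_mem _ _ (hLm _ (by omega))
      · rw [bracketBilin_L_W, hc n m hn hm, zero_smul, add_zero]
        exact Submodule.smul_mem _ _ (hWm _ (by omega))
      · rw [bracketBilin_W_L, hc m n hm hn, zero_smul, add_zero]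
        exact Submodule.neg_mem _ (Submodule.smul_mem _ _ (hWm _ (by omega)))
      · rw [bracketBilin_W_W]
        exact Submodule.zero_mem _
    · intro b _
      simp
    · intro a _
      simp
    · intro a b c _ _ _ h1 h2
      simpa using Submodule.add_mem _ h1 h2
    · intro a b c _ _ _ h1 h2
      simpa using Submodule.add_mem _ h1 h2
    · intro r a b _ _ h
      simpa using Submodule.smul_mem _ r h
    · intro r a b _ _ h
      simpa using Submodule.smul_mem _ r h

theorem L_mem_Wplus {n : ℤ} (hn : 0 < n) : L n ∈ Wplus :=
  Submodule.subset_span ⟨n, hn, Or.inl rfl⟩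

theorem W_mem_Wplus {n : ℤ} (hn : 0 < n) : W n ∈ Wplus :=
  Submodule.subset_span ⟨n, hn, Or.inr rfl⟩

/-- A Lie algebra homomorphism `φ : 𝒲₊ → ℂ` is non-singular if `φ(L_i) φ(W_i) ≠ 0` for
`i = 1, 2`. -/
def IsNonsingular (φ : LieAlgebra.LieCharacter ℂ Wplus) : Prop :=
  φ ⟨L 1, L_mem_Wplus one_pos⟩ * φ ⟨W 1, W_mem_Wplus one_pos⟩ ≠ 0 ∧
    φ ⟨L 2, L_mem_Wplus two_pos⟩ * φ ⟨W 2, W_mem_Wplus two_pos⟩ ≠ 0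

/-- `S(z)`: the subalgebra of the universal enveloping algebra of `W(2,2)` generated by `z`,
that is, the polynomials in `z`. -/
def Sz : Subalgebra ℂ (UniversalEnvelopingAlgebra ℂ W22) :=
  Algebra.adjoin ℂ {UniversalEnvelopingAlgebra.ι ℂ z}

section Modules

variable (V : Type*) [AddCommGroup V] [Module ℂ V] [LieRingModule W22 V] [LieModule ℂ W22 V]

/-- The action of the universal enveloping algebra of `W(2,2)` on a `W(2,2)`-module. -/
def envAction : UniversalEnvelopingAlgebra ℂ W22 →ₐ[ℂ] Module.End ℂ V :=
  UniversalEnvelopingAlgebra.lift ℂ (LieModule.toEnd ℂ W22 V)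

/-- A `W(2,2)`-module is indecomposable if it is nonzero and is not the direct sum of two
nonzero submodules. -/
def IsIndecomposable : Prop :=
  Nontrivial V ∧ ∀ A B : LieSubmodule ℂ W22 V, IsCompl A B → A = ⊥ ∨ B = ⊥

variable {V}

/-- `v` is a Whittaker vector (of type `φ`) if `x v = φ(x) v` for all `x ∈ 𝒲₊`; the zero vector
is included. -/
def IsWhittakerVector (φ : LieAlgebra.LieCharacter ℂ Wplus) (v : V) : Prop :=
  ∀ x : Wplus, ⁅(x : W22), v⁆ = φ x • v

/-- `V` is a Whittaker module of type `φ` with cyclic Whittaker vector `w`: the homomorphism `φ` is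
non-singular, and `w` is a Whittaker vector of type `φ` which generates the `W(2,2)`-module `V`. -/
structure IsCyclicWhittakerVector (φ : LieAlgebra.LieCharacter ℂ Wplus) (w : V) : Prop where
  nonsingular : IsNonsingular φ
  whittaker : IsWhittakerVector φ w
  generates : LieSubmodule.lieSpan ℂ W22 {w} = ⊤

end Modules

end WAlgebra22

end

set_option linter.unusedSectionVars false

noncomputable section

namespace WAlgebra22

open MvPolynomial

/-! Put K = S(z)w. As z is central, K is a z-stable space of Whittaker vectors, and it suffices that
every Whittaker vector in the module generated by K lies in K.

Write x_n for L_n or W_n, give it weight 2 - n, and filter V by the total weight of words applied to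
K. Modulo lower weight the generators commute, φ(x_n) = 0 for n ≥ 3, and x_n - φ(x_n) with n > 0
lowers the weight by n. So words of negative weight kill K, words of weight zero act on K by
scalars, and a leading part is a polynomial in commuting variables x_{-k}, k ≥ 0, of weight k + 2,
with coefficients in K. On such polynomials x_{k+2} - φ(x_{k+2}) acts as a derivation.

For a nonconstant polynomial with largest index k, W_{k+2} acts as -(2k+2)φ(W_2) ∂/∂L_{-k}; if this
gives zero, L_{k+2} acts as the same multiple of ∂/∂W_{-k} (`symbDer_ne_zero`). Iterating takes a
nonzero homogeneous polynomial to a nonzero constant (`exists_derList_ne_zero`). On a Whittaker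
vector these operators give zero, so in positive weight its leading part vanishes and its weight
drops (`IsWhittakerVector.mem_filtAll_pred`); at weight zero it is in K. Symbols belong to words
rather than to vectors, so no freeness of V over S(z) is needed. -/

/-- Indices of the generators `L_n` (`(false, n)`) and `W_n` (`(true, n)`). -/
abbrev Idx : Type := Bool × ℤ

/-- Indices of the variables: `(a, k)` stands for the generator of degree `-k` of kind `a`. -/
abbrev Var : Type := Bool × ℕ

/-- The generator with a given index. -/
def gen : Idx → W22
  | (false, n) => L n
  | (true, n) => W n

/-- The index of the generator occurring in the bracket of two generators. -/
def mulIdx (g h : Idx) : Idx := (g.1 || h.1, g.2 + h.2)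

/-- The coefficient of `gen (mulIdx g h)` in `⁅gen g, gen h⁆`. -/
def strConst (g h : Idx) : ℂ := if g.1 && h.1 then 0 else (h.2 : ℂ) - g.2

/-- The coefficient of `z` in `⁅gen g, gen h⁆`. -/
def zConst (g h : Idx) : ℂ := if g.1 && h.1 then 0 else cocycle g.2 h.2

theorem lie_gen (g h : Idx) :
    ⁅gen g, gen h⁆ = strConst g h • gen (mulIdx g h) + zConst g h • z := by
  obtain ⟨a, n⟩ := g
  obtain ⟨b, m⟩ := h
  rw [bracket_def]
  cases a <;> cases b <;>
    simp [gen, mulIdx, strConst, zConst, bracketBilin_L_L, bracketBilin_L_W, bracketBilin_W_L,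
      bracketBilin_W_W, add_comm n m]
  rw [cocycle_skew n m]
  module

theorem lie_z (x : W22) : ⁅z, x⁆ = 0 := bracketBilin_z_left x

theorem zConst_eq_zero {g h : Idx} (hgh : g.2 + h.2 ≠ 0) : zConst g h = 0 := by
  unfold zConst cocycle
  split_ifs <;> first | rfl | omega

theorem gen_mem_Wplus {g : Idx} (hg : 0 < g.2) : gen g ∈ Wplus := by
  obtain ⟨a, n⟩ := g
  cases a
  · exact L_mem_Wplus hg
  · exact W_mem_Wplus hg

/-! ### Weights, character values and symbols -/

/-- The weight of a generator: the index shifted so that generators of degree `2` have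
weight zero. -/
def wt (g : Idx) : ℤ := 2 - g.2

/-- The sum of the weights of a list of generators. -/
def wtList (l : List Idx) : ℤ := (l.map wt).sum

@[simp] theorem wtList_nil : wtList [] = 0 := rfl

@[simp] theorem wtList_cons (g : Idx) (l : List Idx) : wtList (g :: l) = wt g + wtList l := by
  simp [wtList]

/-- The values of a character of `𝒲₊` on the generators, extended by zero. -/
def charVal (φ : LieAlgebra.LieCharacter ℂ Wplus) (g : Idx) : ℂ :=
  if h : 0 < g.2 then φ ⟨gen g, gen_mem_Wplus h⟩ else 0

section Character

variable (φ : LieAlgebra.LieCharacter ℂ Wplus)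

/-- A character kills brackets, and [L_1, x_{n-1}] = (n-2) x_n. -/
theorem charVal_eq_zero {g : Idx} (hg : 3 ≤ g.2) : charVal φ g = 0 := by
  have h1 : 0 < g.2 := by omega
  rw [charVal, dif_pos h1]
  have hL : gen (false, 1) ∈ Wplus := gen_mem_Wplus one_pos
  have hg' : gen (g.1, g.2 - 1) ∈ Wplus := gen_mem_Wplus (by change 0 < g.2 - 1; omega)
  have key := LieAlgebra.lieCharacter_apply_lie φ ⟨_, hL⟩ ⟨_, hg'⟩
  have hc : ((g.2 : ℂ) - 2) ≠ 0 := by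
    rw [sub_ne_zero]
    exact_mod_cast (show g.2 ≠ 2 by omega)
  have e : (⁅(⟨_, hL⟩ : Wplus), (⟨_, hg'⟩ : Wplus)⁆ : Wplus)
      = ((g.2 : ℂ) - 2) • ⟨gen g, gen_mem_Wplus h1⟩ := by
    apply Subtype.ext
    change ⁅gen (false, 1), gen (g.1, g.2 - 1)⁆ = ((g.2 : ℂ) - 2) • gen g
    rw [lie_gen, zConst_eq_zero (by change 1 + (g.2 - 1) ≠ 0; omega)]
    have : mulIdx (false, 1) (g.1, g.2 - 1) = g := by
      ext <;> simp [mulIdx]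
    rw [this]
    simp only [strConst, Bool.false_and, Bool.false_eq_true, if_false, zero_smul, add_zero]
    push_cast
    congr 1
    ring
  rw [e, map_smul, smul_eq_mul] at key
  exact (mul_eq_zero.mp key).resolve_left hc

/-- The symbol of a generator. -/
def symb (g : Idx) : MvPolynomial Var ℂ :=
  if g.2 ≤ 0 then X (g.1, (-g.2).toNat) else if g.2 = 2 then C (charVal φ g) else 0

/-- The symbol of a product of generators. -/
def symbList (l : List Idx) : MvPolynomial Var ℂ := (l.map (symb φ)).prod

/-- The generator of nonpositive degree attached to a variable. -/
def low (p : Var) : Idx := (p.1, -(p.2 : ℤ))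

/-- The generator of degree `k + 2` attached to the variable `(a, k)`. -/
def high (p : Var) : Idx := (p.1, (p.2 : ℤ) + 2)

/-- The weight of a variable. -/
def varWt (p : Var) : ℤ := p.2 + 2

theorem wt_low (p : Var) : wt (low p) = varWt p := by simp [wt, low, varWt]; ring

/-- The derivation by which `high p` acts on symbols. -/
def symbDer (p : Var) : Derivation ℂ (MvPolynomial Var ℂ) (MvPolynomial Var ℂ) :=
  mkDerivation ℂ fun q => strConst (high p) (low q) • symb φ (mulIdx (high p) (low q))

theorem symb_low (p : Var) : symb φ (low p) = X p := by
  simp [symb, low]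

theorem symbDer_symb (p : Var) (g : Idx) :
    symbDer φ p (symb φ g) = strConst (high p) g • symb φ (mulIdx (high p) g) := by
  rcases le_or_gt g.2 0 with h | h
  · have hg : g = low (g.1, (-g.2).toNat) := by
      ext
      · rfl
      · simp [low]; omega
    rw [hg, symb_low, symbDer, mkDerivation_X]
  -- In positive degree both sides vanish: the symbol is constant, and the bracket has degree at
  -- least 3.
  · have h2 : symb φ (mulIdx (high p) g) = 0 := by
      have : 3 ≤ (mulIdx (high p) g).2 := by simp [mulIdx, high]; omega
      rw [symb, if_neg (by omega), if_neg (by omega)]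
    rw [h2, smul_zero, symb, if_neg (by omega)]
    split_ifs
    · exact derivation_C _ _
    · exact map_zero _

@[simp] theorem symbList_nil : symbList φ [] = 1 := rfl

@[simp] theorem symbList_cons (g : Idx) (l : List Idx) :
    symbList φ (g :: l) = symb φ g * symbList φ l := by
  simp [symbList]

end Character

/-! ### Weight filtration and twisted action -/

section Modules

variable {V : Type*} [AddCommGroup V] [Module ℂ V] [LieRingModule W22 V] [LieModule ℂ W22 V]

/-- The action of a product of generators. -/
def word (l : List Idx) (v : V) : V := l.foldr (fun g u => ⁅gen g, u⁆) v

@[simp] theorem word_nil (v : V) : word [] v = v := rfl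

@[simp] theorem word_cons (g : Idx) (l : List Idx) (v : V) : word (g :: l) v = ⁅gen g, word l v⁆ :=
  rfl

theorem lie_z_comm (x : W22) (v : V) : ⁅z, ⁅x, v⁆⁆ = ⁅x, ⁅z, v⁆⁆ := by
  rw [leibniz_lie, lie_z, zero_lie, zero_add]

theorem lie_z_word (l : List Idx) (v : V) : ⁅z, word l v⁆ = word l ⁅z, v⁆ := by
  induction l with
  | nil => rfl
  | cons g l ih => rw [word_cons, word_cons, lie_z_comm, ih]

theorem word_smul (l : List Idx) (c : ℂ) (v : V) : word l (c • v) = c • word l v := by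
  induction l with
  | nil => rfl
  | cons g l ih => rw [word_cons, word_cons, ih, lie_smul]

theorem word_add (l : List Idx) (u v : V) : word l (u + v) = word l u + word l v := by
  induction l with
  | nil => rfl
  | cons g l ih => rw [word_cons, word_cons, word_cons, ih, lie_add]

/-- The span of the products of at most `r` generators of total weight at most `N` applied to
vectors of `K`. -/
def filt (K : Submodule ℂ V) (r : ℕ) (N : ℤ) : Submodule ℂ V :=
  Submodule.span ℂ {v | ∃ l : List Idx, ∃ κ ∈ K, l.length ≤ r ∧ wtList l ≤ N ∧ v = word l κ}

/-- Pairs of a polynomial, homogeneous of weight `N`, and a vector which it represents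
modulo terms of lower weight. -/
def symbRel (φ : LieAlgebra.LieCharacter ℂ Wplus) (K : Submodule ℂ V) (κ : V) (r : ℕ) (N : ℤ) :
    Submodule ℂ (MvPolynomial Var ℂ × V) :=
  Submodule.span ℂ ({p | ∃ l : List Idx, l.length ≤ r ∧ wtList l = N ∧ p = (symbList φ l, word l κ)}
    ∪ {p | ∃ v ∈ filt K r (N - 1), p = (0, v)})

/-- The twisted action `x - φ(x)` of a generator. -/
def twist (φ : LieAlgebra.LieCharacter ℂ Wplus) (g : Idx) : Module.End ℂ V :=
  LieModule.toEnd ℂ W22 V (gen g) - charVal φ g • LinearMap.id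

theorem twist_apply (φ : LieAlgebra.LieCharacter ℂ Wplus) (g : Idx) (v : V) :
    twist φ g v = ⁅gen g, v⁆ - charVal φ g • v := rfl

variable {φ : LieAlgebra.LieCharacter ℂ Wplus} {K : Submodule ℂ V} {κ : V} {r s : ℕ} {M N : ℤ}

theorem IsWhittakerVector.twist_eq_zero {v : V} (hv : IsWhittakerVector φ v) {g : Idx}
    (hg : 0 < g.2) : twist φ g v = 0 := by
  rw [twist_apply, charVal, dif_pos hg, ← hv ⟨gen g, gen_mem_Wplus hg⟩, sub_self]

theorem word_mem_filt {l : List Idx} (hκ : κ ∈ K) (hl : l.length ≤ r) (hN : wtList l ≤ N) :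
    word l κ ∈ filt K r N :=
  Submodule.subset_span ⟨l, κ, hκ, hl, hN, rfl⟩

theorem filt_mono (hr : r ≤ s) (hN : M ≤ N) : filt K r M ≤ filt K s N :=
  Submodule.span_mono fun _ ⟨l, κ, hκ, hl, hM, e⟩ => ⟨l, κ, hκ, hl.trans hr, hM.trans hN, e⟩

theorem lie_mem_filt {v : V} (hv : v ∈ filt K r N) {g : Idx} (hs : r + 1 ≤ s)
    (hM : wt g + N ≤ M) : ⁅gen g, v⁆ ∈ filt K s M := by
  have : filt K r N ≤ (filt K s M).comap (LieModule.toEnd ℂ W22 V (gen g)) := by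
    refine Submodule.span_le.mpr ?_
    rintro _ ⟨l, κ, hκ, hl, hN, rfl⟩
    refine Submodule.subset_span ⟨g :: l, κ, hκ, ?_, ?_, rfl⟩
    · simp only [List.length_cons]; omega
    · simp only [wtList_cons]; omega
  exact this hv

theorem word_mem_symbRel (l : List Idx) (hl : l.length ≤ r) (hN : wtList l = N) :
    (symbList φ l, word l κ) ∈ symbRel φ K κ r N :=
  Submodule.subset_span (Or.inl ⟨l, hl, hN, rfl⟩)

theorem lower_mem_symbRel {v : V} (hv : v ∈ filt K r (N - 1)) :
    ((0 : MvPolynomial Var ℂ), v) ∈ symbRel φ K κ r N :=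
  Submodule.subset_span (Or.inr ⟨v, hv, rfl⟩)

theorem lie_mem_symbRel {p : MvPolynomial Var ℂ × V} (hp : p ∈ symbRel φ K κ r N) (g : Idx) :
    (symb φ g * p.1, ⁅gen g, p.2⁆) ∈ symbRel φ K κ (r + 1) (wt g + N) := by
  have : symbRel φ K κ r N ≤ (symbRel φ K κ (r + 1) (wt g + N)).comap
      ((LinearMap.mulLeft ℂ (symb φ g)).prodMap (LieModule.toEnd ℂ W22 V (gen g))) := by
    refine Submodule.span_le.mpr ?_
    rintro _ (⟨l, hl, hN, rfl⟩ | ⟨v, hv, rfl⟩)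
    · refine Submodule.subset_span (Or.inl ⟨g :: l, ?_, ?_, ?_⟩)
      · simpa using hl
      · simp [hN]
      · simp
    · refine Submodule.subset_span (Or.inr ⟨⁅gen g, v⁆, lie_mem_filt hv le_rfl (by omega), ?_⟩)
      simp
  exact this hp

/-- Stability properties of a space of Whittaker vectors. -/
structure IsWhittakerSpace (φ : LieAlgebra.LieCharacter ℂ Wplus) (K : Submodule ℂ V) : Prop where
  whittaker : ∀ κ ∈ K, IsWhittakerVector φ κ
  z_mem : ∀ κ ∈ K, ⁅z, κ⁆ ∈ K

theorem twist_cons (g h : Idx) (l : List Idx) (v : V) :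
    twist φ g (word (h :: l) v) = strConst g h • word (mulIdx g h :: l) v +
      zConst g h • word l ⁅z, v⁆ + ⁅gen h, twist φ g (word l v)⁆ := by
  simp only [twist_apply, word_cons, ← lie_z_word]
  rw [leibniz_lie, lie_gen, add_lie, smul_lie, smul_lie, lie_sub, lie_smul]
  abel

/-- A central term arises only in total degree 0, where g and h disappear and their bracket would
have had weight 2: hence the extra drop by 2, which makes these terms negligible for symbols. -/
theorem zterm_mem_filt (hK : IsWhittakerSpace φ K) (hκ : κ ∈ K) (g h : Idx) (l : List Idx)
    (hr : l.length ≤ r) (hN : wt h + wtList l - g.2 - 2 ≤ N) :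
    zConst g h • word l ⁅z, κ⁆ ∈ filt K r N := by
  by_cases hgh : g.2 + h.2 = 0
  · refine Submodule.smul_mem _ _ (word_mem_filt (hK.z_mem κ hκ) hr ?_)
    simp only [wt] at hN
    omega
  · rw [zConst_eq_zero hgh, zero_smul]
    exact zero_mem _

/-- Commuting g through the word replaces some h by [g, h], of weight wt h - g.2, and at the end g -
φ(g) kills κ. The length does not grow, which later permits induction on it. -/
theorem twist_word_mem_filt (hK : IsWhittakerSpace φ K) (hκ : κ ∈ K) {g : Idx} (hg : 0 < g.2)
    (l : List Idx) : twist φ g (word l κ) ∈ filt K l.length (wtList l - g.2) := by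
  induction l with
  | nil => rw [word_nil, (hK.whittaker κ hκ).twist_eq_zero hg]; exact zero_mem _
  | cons h l ih =>
    rw [twist_cons]
    refine add_mem (add_mem (Submodule.smul_mem _ _ (word_mem_filt hκ (by simp) ?_))
      (zterm_mem_filt hK hκ g h l (by simp) ?_)) (lie_mem_filt ih (by simp) ?_) <;>
    simp only [wtList_cons, wt, mulIdx] <;> omega

theorem twist_mem_filt (hK : IsWhittakerSpace φ K) {g : Idx} (hg : 0 < g.2) {v : V}
    (hv : v ∈ filt K r N) (hM : N - g.2 ≤ M) : twist φ g v ∈ filt K r M := by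
  have : filt K r N ≤ (filt K r M).comap (twist φ g) := by
    refine Submodule.span_le.mpr ?_
    rintro _ ⟨l, κ, hκ, hl, hN, rfl⟩
    exact filt_mono hl (by omega) (twist_word_mem_filt hK hκ hg l)
  exact this hv

theorem high_pos (p : Var) : 0 < (high p).2 := by simp [high]; omega

/-- Commuting `high p` through a word is the Leibniz rule on its symbol; central terms fall into
lower weight and pair with 0. -/
theorem twist_word_mem_symbRel (hK : IsWhittakerSpace φ K) (hκ : κ ∈ K) (p : Var) (l : List Idx) :
    (symbDer φ p (symbList φ l), twist φ (high p) (word l κ)) ∈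
      symbRel φ K κ l.length (wtList l - varWt p) := by
  induction l with
  | nil =>
    rw [word_nil, (hK.whittaker κ hκ).twist_eq_zero (high_pos p), symbList_nil,
      Derivation.map_one_eq_zero]
    exact zero_mem _
  | cons h l ih =>
    have e : (symbDer φ p (symbList φ (h :: l)), twist φ (high p) (word (h :: l) κ)) =
        strConst (high p) h • (symbList φ (mulIdx (high p) h :: l), word (mulIdx (high p) h :: l) κ)
        + (0, zConst (high p) h • word l ⁅z, κ⁆)
        + (symb φ h * symbDer φ p (symbList φ l), ⁅gen h, twist φ (high p) (word l κ)⁆) := by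
      rw [twist_cons, Prod.smul_mk, Prod.mk_add_mk, Prod.mk_add_mk, symbList_cons, symbList_cons,
        Derivation.leibniz, symbDer_symb, add_zero, smul_eq_mul, smul_eq_mul]
      congr 1
      rw [← smul_mul_assoc]
      ring
    rw [e]
    have h2 : (high p).2 = varWt p := rfl
    refine add_mem (add_mem (Submodule.smul_mem _ _ (word_mem_symbRel _ (by simp) ?_))
      (lower_mem_symbRel (zterm_mem_filt hK hκ _ h l (by simp) ?_))) ?_
    · simp only [wtList_cons, wt, mulIdx, h2]; omega
    · simp only [wtList_cons, h2]; omega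
    · have := lie_mem_symbRel ih h
      rwa [← add_sub_assoc] at this

theorem twist_mem_symbRel (hK : IsWhittakerSpace φ K) (hκ : κ ∈ K) (q : Var)
    {p : MvPolynomial Var ℂ × V} (hp : p ∈ symbRel φ K κ r N) :
    (symbDer φ q p.1, twist φ (high q) p.2) ∈ symbRel φ K κ r (N - varWt q) := by
  have hmono : ∀ {m : ℕ}, m ≤ r → ∀ {A : ℤ}, symbRel φ K κ m A ≤ symbRel φ K κ r A := by
    intro m hm A
    refine Submodule.span_mono (Set.union_subset_union ?_ ?_)
    · rintro _ ⟨l, hl, hA, rfl⟩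
      exact ⟨l, hl.trans hm, hA, rfl⟩
    · rintro _ ⟨v, hv, rfl⟩
      exact ⟨v, filt_mono hm le_rfl hv, rfl⟩
  have : symbRel φ K κ r N ≤ (symbRel φ K κ r (N - varWt q)).comap
      ((symbDer φ q).toLinearMap.prodMap (twist φ (high q))) := by
    refine Submodule.span_le.mpr ?_
    rintro _ (⟨l, hl, rfl, rfl⟩ | ⟨v, hv, rfl⟩)
    · exact hmono hl (twist_word_mem_symbRel hK hκ q l)
    · have h2 : (high q).2 = varWt q := rfl
      have := lower_mem_symbRel (φ := φ) (κ := κ) (N := N - varWt q)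
        (twist_mem_filt hK (high_pos q) hv (M := N - varWt q - 1) (by omega))
      simpa using this
  exact this hp

/-! ### Words of nonpositive weight -/

theorem lie_gen_eq (φ : LieAlgebra.LieCharacter ℂ Wplus) (g : Idx) (v : V) :
    ⁅gen g, v⁆ = charVal φ g • v + twist φ g v := by
  rw [twist_apply]; abel

/-- Weights can be negative, so the induction is on length. A leading generator of degree at most 2
leaves a tail of negative weight; one of degree at least 3 acts by its twist, giving shorter words
of weight still negative. -/
theorem word_eq_zero (hK : IsWhittakerSpace φ K) (r : ℕ) :
    ∀ (l : List Idx), ∀ κ ∈ K, l.length ≤ r → wtList l < 0 → word l κ = 0 := by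
  induction r with
  | zero =>
    intro l κ hκ hl hN
    obtain rfl : l = [] := by simpa using hl
    simp at hN
  | succ r ih =>
    intro l κ hκ hl hN
    rcases l with _ | ⟨g, l⟩
    · simp at hN
    simp only [List.length_cons, wtList_cons, wt] at hl hN
    rw [word_cons]
    by_cases hg : g.2 ≤ 2
    · rw [ih l κ hκ (by omega) (by omega), lie_zero]
    · have h0 : filt K r (-1) ≤ ⊥ := by
        refine Submodule.span_le.mpr ?_
        rintro _ ⟨l', κ', hκ', hl', hN', rfl⟩
        exact ih l' κ' hκ' hl' (by omega)
      rw [lie_gen_eq φ, charVal_eq_zero φ (by omega), zero_smul, zero_add]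
      exact h0 (filt_mono (by omega) (by omega) (twist_word_mem_filt hK hκ (by omega : 0 < g.2) l))

theorem filt_eq_bot (hK : IsWhittakerSpace φ K) (hN : N < 0) : filt K r N = ⊥ := by
  refine le_bot_iff.mp (Submodule.span_le.mpr ?_)
  rintro _ ⟨l, κ, hκ, hl, hl', rfl⟩
  exact word_eq_zero hK _ l κ hκ le_rfl (by omega)

theorem twist_word_eq_zero (hK : IsWhittakerSpace φ K) (hκ : κ ∈ K) {g : Idx} {l : List Idx}
    (hg : 0 < g.2) (hl : wtList l < g.2) : twist φ g (word l κ) = 0 := by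
  have := twist_word_mem_filt hK hκ hg l
  rwa [filt_eq_bot hK (by omega), Submodule.mem_bot] at this

theorem word_eq_constantCoeff (hK : IsWhittakerSpace φ K) (hκ : κ ∈ K) (l : List Idx)
    (hl : wtList l = 0) : word l κ = constantCoeff (symbList φ l) • κ := by
  induction l with
  | nil => simp
  | cons g l ih =>
    rw [wtList_cons, wt] at hl
    rw [symbList_cons, map_mul, symb]
    split_ifs with h1 h2
    · rw [constantCoeff_X, zero_mul, zero_smul, word_cons,
        word_eq_zero hK _ l κ hκ le_rfl (by omega), lie_zero]
    · rw [constantCoeff_C, mul_smul, ← ih (by omega), word_cons, lie_gen_eq φ,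
        twist_word_eq_zero hK hκ (by omega) (by omega), add_zero]
    · rw [map_zero, zero_mul, zero_smul, word_cons]
      by_cases h3 : g.2 = 1
      · rw [word_eq_zero hK _ l κ hκ le_rfl (by omega), lie_zero]
      · rw [lie_gen_eq φ, charVal_eq_zero φ (by omega), zero_smul, zero_add,
          twist_word_eq_zero hK hκ (by omega) (by omega)]

theorem eq_constantCoeff_of_mem_symbRel (hK : IsWhittakerSpace φ K) (hκ : κ ∈ K)
    {p : MvPolynomial Var ℂ × V} (hp : p ∈ symbRel φ K κ r 0) :
    p.2 = constantCoeff p.1 • κ := by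
  refine Submodule.span_induction ?_ ?_ ?_ ?_ hp
  · rintro _ (⟨l, -, hN, rfl⟩ | ⟨v, hv, rfl⟩)
    · exact word_eq_constantCoeff hK hκ l hN
    · rw [filt_eq_bot hK (by omega), Submodule.mem_bot] at hv
      simp [hv]
  · simp
  · intro x y _ _ hx hy
    simp [hx, hy, add_smul]
  · intro a x _ hx
    simp [hx, mul_smul, MvPolynomial.smul_eq_C_mul]

/-! ### Iterated twists down to weight zero -/

/-- Successive application of twisted actions. -/
def twistList (φ : LieAlgebra.LieCharacter ℂ Wplus) : List Var → Module.End ℂ V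
  | [] => 1
  | p :: d => twistList φ d * twist φ (high p)

/-- Successive application of the derivations `symbDer`. -/
def derList (φ : LieAlgebra.LieCharacter ℂ Wplus) : List Var → Module.End ℂ (MvPolynomial Var ℂ)
  | [] => 1
  | p :: d => derList φ d * (symbDer φ p).toLinearMap

theorem twistList_of_mem_symbRel (hK : IsWhittakerSpace φ K) (hκ : κ ∈ K) (d : List Var) :
    ∀ {p : MvPolynomial Var ℂ × V}, p ∈ symbRel φ K κ r (d.map varWt).sum →
      twistList φ d p.2 = constantCoeff (derList φ d p.1) • κ := by
  induction d with
  | nil => intro p hp; exact eq_constantCoeff_of_mem_symbRel hK hκ hp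
  | cons q d ih =>
    intro p hp
    have := twist_mem_symbRel hK hκ q hp
    rw [List.map_cons, List.sum_cons, add_sub_cancel_left] at this
    exact ih this

theorem twistList_of_mem_filt (hK : IsWhittakerSpace φ K) (d : List Var) :
    ∀ {v : V} {N : ℤ}, v ∈ filt K r N → N < (d.map varWt).sum → twistList φ d v = 0 := by
  induction d with
  | nil =>
    intro v N hv hN
    rwa [filt_eq_bot hK (by simpa using hN), Submodule.mem_bot] at hv
  | cons q d ih =>
    intro v N hv hN
    rw [List.map_cons, List.sum_cons] at hN
    have h2 : (high q).2 = varWt q := rfl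
    exact ih (twist_mem_filt hK (high_pos q) hv le_rfl) (by omega)

theorem twistList_whittaker {v : V} (hv : IsWhittakerVector φ v) {d : List Var} (hd : d ≠ []) :
    twistList φ d v = 0 := by
  rcases d with _ | ⟨p, d⟩
  · exact absurd rfl hd
  · change twistList φ d (twist φ (high p) v) = 0
    rw [hv.twist_eq_zero (high_pos p), map_zero]

end Modules

/-! ### Derivations detect nonconstant symbols -/

theorem symb_isWeightedHomogeneous (φ : LieAlgebra.LieCharacter ℂ Wplus) (g : Idx) :
    IsWeightedHomogeneous varWt (symb φ g) (wt g) := by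
  unfold symb
  split_ifs with h1 h2
  · have e : wt g = varWt (g.1, (-g.2).toNat) := by simp [wt, varWt]; omega
    rw [e]
    exact isWeightedHomogeneous_X ℂ _ _
  · rw [wt, h2, sub_self]
    exact isWeightedHomogeneous_C _ _
  · exact isWeightedHomogeneous_zero _ _ _

theorem isWeightedHomogeneous_mkDerivation {σ : Type*} {w : σ → ℤ} {F : σ → MvPolynomial σ ℂ}
    {m N : ℤ} (hF : ∀ i, IsWeightedHomogeneous w (F i) (w i - m)) {f : MvPolynomial σ ℂ}
    (hf : IsWeightedHomogeneous w f N) :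
    IsWeightedHomogeneous w (mkDerivation ℂ F f) (N - m) := by
  rw [f.as_sum, map_sum]
  refine IsWeightedHomogeneous.sum _ _ _ fun s hs => ?_
  rw [mkDerivation_monomial]
  refine (weightedHomogeneousSubmodule ℂ w (N - m)).smul_mem _ ?_
  refine Submodule.sum_mem _ fun i hi => ?_
  have hsN : Finsupp.weight w s = N := hf (mem_support_iff.mp hs)
  have hle : Finsupp.single i 1 ≤ s :=
    Finsupp.single_le_iff.mpr (Nat.one_le_iff_ne_zero.mpr (Finsupp.mem_support_iff.mp hi))
  have hw : Finsupp.weight w (s - Finsupp.single i 1) + w i = N := by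
    rw [← hsN]
    conv_rhs => rw [← tsub_add_cancel_of_le hle]
    rw [map_add, Finsupp.weight_single, one_smul]
  have e : N - m = Finsupp.weight w (s - Finsupp.single i 1) + (w i - m) := by omega
  rw [mem_weightedHomogeneousSubmodule, e]
  exact (isWeightedHomogeneous_monomial _ _ _ rfl).mul (hF i)

theorem pderiv_ne_zero_of_mem_vars {σ : Type*} {f : MvPolynomial σ ℂ} {i : σ} (hi : i ∈ f.vars) :
    pderiv i f ≠ 0 := by
  obtain ⟨s, hs, his⟩ := (mem_vars_iff_mem_support i).mp hi
  have hle : Finsupp.single i 1 ≤ s :=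
    Finsupp.single_le_iff.mpr (Nat.one_le_iff_ne_zero.mpr (Finsupp.mem_support_iff.mp his))
  intro h
  have := coeff_pderiv (i := i) f (s - Finsupp.single i 1)
  rw [h, tsub_add_cancel_of_le hle, coeff_zero] at this
  exact mul_ne_zero (mem_support_iff.mp hs) (Nat.cast_add_one_ne_zero _) this.symm

theorem symbDer_ne_zero {φ : LieAlgebra.LieCharacter ℂ Wplus} (hφ : charVal φ (true, 2) ≠ 0)
    {f : MvPolynomial Var ℂ} (hf : f.vars.Nonempty) : ∃ p, symbDer φ p f ≠ 0 := by
  -- With k maximal, degree k + 2 sends every smaller variable to degree above 2, where symbols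
  -- vanish, and those of index k to constants.
  obtain ⟨⟨b, k⟩, hbk, hmax⟩ := f.vars.exists_max_image Prod.snd hf
  have hk : (-(k : ℂ) - (k + 2)) ≠ 0 := by
    have : ((2 * k + 1 : ℕ) : ℂ) + 1 ≠ 0 := Nat.cast_add_one_ne_zero _
    intro h
    apply this
    push_cast
    linear_combination -h
  have hcase : ∀ q ∈ f.vars, q = (false, k) ∨ q = (true, k) ∨ q.2 < k := by
    rintro ⟨a, j⟩ hq
    have : j ≤ k := hmax _ hq
    rcases this.lt_or_eq with h | rfl
    · exact Or.inr (Or.inr h)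
    · cases a <;> simp
  have hlow : ∀ (a : Bool) (q : Var), q.2 < k → symbDer φ (a, k) (X q) = 0 := by
    intro a q hq
    rw [symbDer, mkDerivation_X, symb, if_neg, if_neg, smul_zero] <;>
      simp only [mulIdx, high, low] <;> omega
  have hsame : ∀ a b : Bool, symbDer φ (a, k) (X (b, k)) =
      C (if a && b then 0 else (-(k : ℂ) - (k + 2)) * charVal φ (a || b, 2)) := by
    intro a b
    have e : mulIdx (high (a, k)) (low (b, k)) = (a || b, 2) := by simp [mulIdx, high, low]
    rw [symbDer, mkDerivation_X, e, symb, if_neg (by norm_num), if_pos rfl, smul_eq_C_mul, ← C_mul,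
      strConst]
    cases a <;> cases b <;> simp [high, low]
  have hW : symbDer φ (true, k) f =
      ((-(k : ℂ) - (k + 2)) * charVal φ (true, 2)) • pderiv (false, k) f := by
    rw [← Derivation.smul_apply]
    refine derivation_eq_of_forall_mem_vars fun q hq => ?_
    rw [Derivation.smul_apply]
    rcases hcase q hq with rfl | rfl | h
    · rw [hsame, pderiv_X_self, smul_eq_C_mul]; simp
    · rw [hsame, pderiv_X_of_ne (by simp)]; simp
    · rw [hlow _ _ h, pderiv_X_of_ne (by rintro rfl; simp at h), smul_zero]
  have hL : symbDer φ (false, k) f =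
      ((-(k : ℂ) - (k + 2)) * charVal φ (false, 2)) • pderiv (false, k) f +
      ((-(k : ℂ) - (k + 2)) * charVal φ (true, 2)) • pderiv (true, k) f := by
    rw [← Derivation.smul_apply, ← Derivation.smul_apply, ← Derivation.add_apply]
    refine derivation_eq_of_forall_mem_vars fun q hq => ?_
    rw [Derivation.add_apply, Derivation.smul_apply, Derivation.smul_apply]
    rcases hcase q hq with rfl | rfl | h
    · rw [hsame, pderiv_X_self, pderiv_X_of_ne (by simp), smul_eq_C_mul]; simp
    · rw [hsame, pderiv_X_self, pderiv_X_of_ne (by simp), smul_eq_C_mul]; simp [smul_eq_C_mul]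
    · rw [hlow _ _ h, pderiv_X_of_ne (by rintro rfl; simp at h),
        pderiv_X_of_ne (by rintro rfl; simp at h), smul_zero, smul_zero, add_zero]
  -- The action is triangular: W_{k+2} sees only L_{-k} because the W's commute, and L_{k+2} then
  -- sees W_{-k}.
  by_cases h : pderiv (false, k) f = 0
  · refine ⟨(false, k), ?_⟩
    rw [hL, h, smul_zero, zero_add]
    refine smul_ne_zero (mul_ne_zero hk hφ) ?_
    cases b
    · exact absurd h (pderiv_ne_zero_of_mem_vars hbk)
    · exact pderiv_ne_zero_of_mem_vars hbk
  · exact ⟨(true, k), hW ▸ smul_ne_zero (mul_ne_zero hk hφ) h⟩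

theorem symbDer_isWeightedHomogeneous (φ : LieAlgebra.LieCharacter ℂ Wplus) (p : Var) {N : ℤ}
    {f : MvPolynomial Var ℂ} (hf : IsWeightedHomogeneous varWt f N) :
    IsWeightedHomogeneous varWt (symbDer φ p f) (N - varWt p) := by
  refine isWeightedHomogeneous_mkDerivation (fun q => ?_) hf
  refine (weightedHomogeneousSubmodule ℂ _ _).smul_mem _ ?_
  have := symb_isWeightedHomogeneous φ (mulIdx (high p) (low q))
  have e : wt (mulIdx (high p) (low q)) = varWt q - varWt p := by
    simp only [wt, mulIdx, high, low, varWt]; ring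
  rwa [e] at this

theorem weight_nonneg (s : Var →₀ ℕ) : 0 ≤ Finsupp.weight varWt s := by
  rw [Finsupp.weight_apply]
  refine Finset.sum_nonneg fun p _ => nsmul_nonneg ?_ _
  simp only [varWt]; omega

theorem exists_derList_ne_zero {φ : LieAlgebra.LieCharacter ℂ Wplus}
    (hφ : charVal φ (true, 2) ≠ 0) (N : ℕ) :
    ∀ {f : MvPolynomial Var ℂ}, IsWeightedHomogeneous varWt f (N : ℤ) → f ≠ 0 →
      ∃ d : List Var, (d.map varWt).sum = N ∧ constantCoeff (derList φ d f) ≠ 0 := by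
  induction N using Nat.strong_induction_on with
  | _ N ih =>
  intro f hf hf0
  rcases f.vars.eq_empty_or_nonempty with h | h
  · obtain ⟨c, rfl⟩ : ∃ c, f = C c := ⟨_, vars_eq_empty_iff_eq_C.mp h⟩
    refine ⟨[], ?_, ?_⟩
    · have := hf.inj_right hf0 (isWeightedHomogeneous_C varWt c)
      simpa using this.symm
    · simpa [derList] using hf0
  · obtain ⟨p, hp⟩ := symbDer_ne_zero hφ h
    have hD := symbDer_isWeightedHomogeneous φ p hf
    obtain ⟨s, hs⟩ := ne_zero_iff.mp hp
    have hs' := hD hs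
    have hnn := weight_nonneg s
    have hpos : 0 < varWt p := high_pos p
    obtain ⟨M, hM⟩ := Int.eq_ofNat_of_zero_le (hs' ▸ hnn)
    rw [hM] at hD
    obtain ⟨d, hd, hd'⟩ := ih M (by omega) hD hp
    exact ⟨p :: d, by simp [hd]; omega, hd'⟩

/-! ### Reordering and standard monomials -/

section Modules

variable {V : Type*} [AddCommGroup V] [Module ℂ V] [LieRingModule W22 V] [LieModule ℂ W22 V]

/-- The span of the products of generators of total weight at most `N` applied to vectors
of `K`. -/
def filtAll (K : Submodule ℂ V) (N : ℤ) : Submodule ℂ V :=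
  Submodule.span ℂ {v | ∃ l : List Idx, ∃ κ ∈ K, wtList l ≤ N ∧ v = word l κ}

variable {φ : LieAlgebra.LieCharacter ℂ Wplus} {K : Submodule ℂ V} {κ : V} {M N : ℤ}

theorem filt_le_filtAll (r : ℕ) : filt K r N ≤ filtAll K N :=
  Submodule.span_mono fun _ ⟨l, κ, hκ, _, hN, e⟩ => ⟨l, κ, hκ, hN, e⟩

theorem exists_mem_filt_of_mem_filtAll {v : V} (hv : v ∈ filtAll K N) : ∃ r, v ∈ filt K r N := by
  refine Submodule.span_induction ?_ ?_ ?_ ?_ hv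
  · rintro _ ⟨l, κ, hκ, hN, rfl⟩
    exact ⟨l.length, word_mem_filt hκ le_rfl hN⟩
  · exact ⟨0, zero_mem _⟩
  · rintro x y _ _ ⟨r, hr⟩ ⟨s, hs⟩
    exact ⟨max r s, add_mem (filt_mono (le_max_left _ _) le_rfl hr)
      (filt_mono (le_max_right _ _) le_rfl hs)⟩
  · rintro a x _ ⟨r, hr⟩
    exact ⟨r, Submodule.smul_mem _ _ hr⟩

theorem word_mem_filtAll {l : List Idx} (hκ : κ ∈ K) (hN : wtList l ≤ N) :
    word l κ ∈ filtAll K N :=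
  Submodule.subset_span ⟨l, κ, hκ, hN, rfl⟩

theorem filtAll_mono (hN : M ≤ N) : filtAll K M ≤ filtAll K N :=
  Submodule.span_mono fun _ ⟨l, κ, hκ, hM, e⟩ => ⟨l, κ, hκ, hM.trans hN, e⟩

theorem lie_mem_filtAll {v : V} (hv : v ∈ filtAll K N) {g : Idx} (hM : wt g + N ≤ M) :
    ⁅gen g, v⁆ ∈ filtAll K M := by
  obtain ⟨r, hr⟩ := exists_mem_filt_of_mem_filtAll hv
  exact filt_le_filtAll _ (lie_mem_filt hr le_rfl hM)

/-- A transposition costs one commutator, of weight 2 less, and a central term of weight lower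
still. -/
theorem word_perm (hK : IsWhittakerSpace φ K) (hκ : κ ∈ K) {l l' : List Idx} (h : l.Perm l') :
    word l κ - word l' κ ∈ filtAll K (wtList l - 1) := by
  induction h with
  | nil => simp
  | cons g h ih =>
    rw [word_cons, word_cons, ← lie_sub]
    exact lie_mem_filtAll ih (by rw [wtList_cons]; omega)
  | swap a b l =>
    simp only [word_cons]
    rw [leibniz_lie (gen b), add_sub_cancel_right, lie_gen, add_lie, smul_lie, smul_lie, ← word_cons,
      lie_z_word]
    refine add_mem (Submodule.smul_mem _ _ (word_mem_filtAll hκ ?_))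
      (filt_le_filtAll _ (zterm_mem_filt hK hκ b a l le_rfl ?_)) <;>
    simp only [wtList_cons, wt, mulIdx] <;> omega
  | trans h1 h2 ih1 ih2 =>
    rw [show wtList _ = wtList _ from (h1.map wt).sum_eq.symm] at ih2
    have := (filtAll K _).add_mem ih1 ih2
    rwa [sub_add_sub_cancel] at this

/-- A list of generators of nonpositive degree with prescribed multiplicities. -/
def stdList (s : Var →₀ ℕ) : List Idx := s.toMultiset.toList.map low

theorem wtList_stdList (s : Var →₀ ℕ) : wtList (stdList s) = Finsupp.weight varWt s := by
  have key (m : Multiset Var) : (m.map varWt).sum = Finsupp.weight varWt m.toFinsupp := by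
    induction m using Multiset.induction with
    | empty => simp
    | cons p m ih =>
      rw [← Multiset.singleton_add, map_add, map_add, Multiset.toFinsupp_singleton,
        Finsupp.weight_single, one_smul, ← ih]
      simp
  have h : (wt ∘ low) = varWt := funext wt_low
  rw [wtList, stdList, List.map_map, h, ← Multiset.sum_coe, ← Multiset.map_coe, Multiset.coe_toList,
    key, Finsupp.toMultiset_toFinsupp]

theorem symbList_stdList (s : Var →₀ ℕ) : symbList φ (stdList s) = monomial s 1 := by
  have key (m : Multiset Var) :
      (m.map (X : Var → MvPolynomial Var ℂ)).prod = monomial m.toFinsupp 1 := by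
    induction m using Multiset.induction with
    | empty => simp
    | cons p m ih =>
      rw [← Multiset.singleton_add, map_add, Multiset.toFinsupp_singleton, Multiset.map_add,
        Multiset.prod_add, ih, Multiset.map_singleton, Multiset.prod_singleton, X, monomial_mul,
        one_mul]
  have h : (symb φ ∘ low) = X := funext (symb_low φ)
  rw [symbList, stdList, List.map_map, h, ← Multiset.prod_coe, ← Multiset.map_coe,
    Multiset.coe_toList, key, Finsupp.toMultiset_toFinsupp]

theorem stdList_perm (p : Var) (s : Var →₀ ℕ) :
    (low p :: stdList s).Perm (stdList (Finsupp.single p 1 + s)) := by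
  unfold stdList
  rw [← List.map_cons]
  refine List.Perm.map _ ?_
  rw [← Multiset.coe_eq_coe, ← Multiset.cons_coe, Multiset.coe_toList, Multiset.coe_toList,
    map_add, Finsupp.toMultiset_single, one_smul, Multiset.singleton_add]

/-- The span of the standard products of weight `N` applied to vectors of `K`. -/
def stdSpan (K : Submodule ℂ V) (N : ℤ) : Submodule ℂ V :=
  Submodule.span ℂ {v | ∃ s, ∃ κ ∈ K, Finsupp.weight varWt s = N ∧ v = word (stdList s) κ}

theorem lie_low_mem (hK : IsWhittakerSpace φ K) (p : Var) {v : V}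
    (hv : v ∈ stdSpan K N ⊔ filtAll K (N - 1)) :
    ⁅gen (low p), v⁆ ∈ stdSpan K (varWt p + N) ⊔ filtAll K (varWt p + N - 1) := by
  have : stdSpan K N ⊔ filtAll K (N - 1) ≤
      (stdSpan K (varWt p + N) ⊔ filtAll K (varWt p + N - 1)).comap
        (LieModule.toEnd ℂ W22 V (gen (low p))) := by
    refine sup_le (Submodule.span_le.mpr ?_) fun u hu => Submodule.mem_sup_right
      (lie_mem_filtAll hu (by rw [wt_low]; omega))
    rintro _ ⟨s, κ, hκ, hN, rfl⟩
    have h1 := word_perm hK hκ (stdList_perm p s)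
    rw [wtList_cons, wt_low, wtList_stdList, hN] at h1
    have h2 : word (stdList (Finsupp.single p 1 + s)) κ ∈ stdSpan K (varWt p + N) := by
      refine Submodule.subset_span ⟨_, κ, hκ, ?_, rfl⟩
      rw [map_add, Finsupp.weight_single, one_smul, hN]
    have := add_mem (Submodule.mem_sup_right h1) (Submodule.mem_sup_left h2)
    rwa [sub_add_cancel] at this
  exact this hv

theorem word_mem_stdSpan (hK : IsWhittakerSpace φ K) (hκ : κ ∈ K) (l : List Idx) :
    word l κ ∈ stdSpan K (wtList l) ⊔ filtAll K (wtList l - 1) := by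
  induction l with
  | nil =>
    refine Submodule.mem_sup_left (Submodule.subset_span ⟨0, κ, hκ, by simp, ?_⟩)
    simp [stdList]
  | cons g l ih =>
    rcases le_or_gt g.2 0 with hg | hg
    · obtain ⟨p, rfl⟩ : ∃ p, g = low p :=
        ⟨(g.1, (-g.2).toNat), Prod.ext rfl (by simp only [low]; omega)⟩
      rw [word_cons, wtList_cons, wt_low]
      exact lie_low_mem hK p ih
    · rw [word_cons, lie_gen_eq φ]
      refine add_mem ?_ (Submodule.mem_sup_right (filt_le_filtAll l.length
        (filt_mono le_rfl ?_ (twist_word_mem_filt hK hκ hg l))))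
      · by_cases h2 : g.2 = 2
        · have : wtList (g :: l) = wtList l := by simp [wt, h2]
          rw [this]
          exact Submodule.smul_mem _ _ ih
        · by_cases h1 : g.2 = 1
          · refine Submodule.mem_sup_right (Submodule.smul_mem _ _ (word_mem_filtAll hκ ?_))
            simp only [wtList_cons, wt]; omega
          · rw [charVal_eq_zero φ (by omega), zero_smul]
            exact zero_mem _
      · simp only [wtList_cons, wt]; omega

theorem filtAll_le (hK : IsWhittakerSpace φ K) : filtAll K N ≤ stdSpan K N ⊔ filtAll K (N - 1) := by
  refine Submodule.span_le.mpr ?_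
  rintro _ ⟨l, κ, hκ, hN, rfl⟩
  rcases hN.lt_or_eq with h | rfl
  · exact Submodule.mem_sup_right (word_mem_filtAll hκ (by omega))
  · exact word_mem_stdSpan hK hκ l

theorem exists_finsupp_of_mem_stdSpan {v : V} (hv : v ∈ stdSpan K N) :
    ∃ t : (Var →₀ ℕ) →₀ K, (∀ s ∈ t.support, Finsupp.weight varWt s = N) ∧
      v = t.sum fun s κ => word (stdList s) (κ : V) := by
  refine Submodule.span_induction ?_ ?_ ?_ ?_ hv
  · rintro _ ⟨s, κ, hκ, hN, rfl⟩
    refine ⟨Finsupp.single s ⟨κ, hκ⟩, fun s' hs' => ?_, ?_⟩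
    · rw [Finset.mem_singleton.mp (Finsupp.support_single_subset hs'), hN]
    · rw [Finsupp.sum_single_index]
      simpa using word_smul (stdList s) 0 (0 : V)
  · exact ⟨0, by simp, by simp⟩
  · rintro x y _ _ ⟨t, ht, rfl⟩ ⟨u, hu, rfl⟩
    classical
    refine ⟨t + u, fun s hs => ?_, ?_⟩
    · rcases Finset.mem_union.mp (Finsupp.support_add hs) with h | h
      · exact ht s h
      · exact hu s h
    · rw [Finsupp.sum_add_index']
      · intro s
        simpa using word_smul (stdList s) 0 (0 : V)
      · intro s a b
        exact word_add _ _ _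
  · rintro a x _ ⟨t, ht, rfl⟩
    refine ⟨a • t, fun s hs => ht s (Finsupp.support_smul hs), ?_⟩
    rw [Finsupp.sum_smul_index', Finsupp.smul_sum]
    · exact Finsupp.sum_congr fun s _ => (word_smul _ _ _).symm
    · intro s
      simpa using word_smul (stdList s) 0 (0 : V)

/-! ### Descent of Whittaker vectors -/

theorem twistList_stdList (hK : IsWhittakerSpace φ K) (hκ : κ ∈ K) {d : List Var} {s : Var →₀ ℕ}
    (hs : Finsupp.weight varWt s = (d.map varWt).sum) :
    twistList φ d (word (stdList s) κ) = constantCoeff (derList φ d (monomial s 1)) • κ := by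
  have := twistList_of_mem_symbRel hK hκ d
    (word_mem_symbRel (φ := φ) (K := K) (κ := κ) (stdList s) le_rfl ((wtList_stdList s).trans hs))
  rwa [symbList_stdList] at this

theorem IsWhittakerVector.mem_filtAll_pred (hφ : charVal φ (true, 2) ≠ 0)
    (hK : IsWhittakerSpace φ K) {v : V} (hv : IsWhittakerVector φ v) {n : ℕ}
    (hn : v ∈ filtAll K ((n : ℤ) + 1)) : v ∈ filtAll K n := by
  obtain ⟨u, hu, v', hv', rfl⟩ := Submodule.mem_sup.mp (filtAll_le hK hn)
  obtain ⟨t, ht, rfl⟩ := exists_finsupp_of_mem_stdSpan hu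
  rw [add_sub_cancel_right] at hv'
  suffices h : t = 0 by simpa [h] using hv'
  by_contra h0
  obtain ⟨s₀, hs₀⟩ := Finsupp.ne_iff.mp h0
  -- A functional turns the K-valued leading part into a nonzero scalar polynomial, to which the
  -- derivations apply.
  obtain ⟨ℓ, hℓ⟩ : ∃ ℓ : Module.Dual ℂ K, ℓ (t s₀) ≠ 0 := by
    by_contra! h
    exact hs₀ ((Module.forall_dual_apply_eq_zero_iff ℂ (t s₀)).mp h)
  set f : MvPolynomial Var ℂ := ∑ s ∈ t.support, ℓ (t s) • monomial s 1 with hf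
  have hf0 : f ≠ 0 := by
    refine ne_zero_iff.mpr ⟨s₀, ?_⟩
    have hs : s₀ ∈ t.support := Finsupp.mem_support_iff.mpr hs₀
    rw [hf, coeff_sum, Finset.sum_eq_single_of_mem s₀ hs]
    · simpa using hℓ
    · intro s _ hs
      simp [coeff_monomial, hs]
  have hfw : IsWeightedHomogeneous varWt f ((n + 1 : ℕ) : ℤ) := by
    refine IsWeightedHomogeneous.sum _ _ _ fun s hs => ?_
    refine (weightedHomogeneousSubmodule ℂ _ _).smul_mem _ ?_
    exact isWeightedHomogeneous_monomial _ _ _ (by rw [ht s hs]; push_cast; rfl)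
  obtain ⟨d, hd, hd'⟩ := exists_derList_ne_zero hφ (n + 1) hfw hf0
  have hdn : d ≠ [] := by
    rintro rfl
    simp only [List.map_nil, List.sum_nil] at hd
    omega
  -- The twists kill v and its lower part, so they kill the leading sum; applying ℓ then contradicts
  -- `hd'`.
  have h1 := twistList_whittaker hv hdn
  obtain ⟨r, hr⟩ := exists_mem_filt_of_mem_filtAll hv'
  rw [map_add, twistList_of_mem_filt hK d hr (by rw [hd]; push_cast; omega), add_zero, Finsupp.sum,
    map_sum, Finset.sum_congr rfl fun s hs => twistList_stdList hK (t s).2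
      ((ht s hs).trans (by rw [hd]; push_cast; rfl))] at h1
  have h2 : ∑ s ∈ t.support, constantCoeff (derList φ d (monomial s 1)) • t s = 0 := by
    apply Subtype.ext
    simpa using h1
  apply hd'
  have h3 := congrArg ℓ h2
  rw [map_sum, map_zero] at h3
  rw [hf, map_sum, map_sum, ← h3]
  refine Finset.sum_congr rfl fun s _ => ?_
  rw [LinearMap.map_smul, LinearMap.map_smul, constantCoeff_smul, smul_eq_mul, smul_eq_mul, mul_comm]

theorem filtAll_zero_le (hK : IsWhittakerSpace φ K) : filtAll K 0 ≤ K := by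
  refine Submodule.span_le.mpr ?_
  rintro _ ⟨l, κ, hκ, hN, rfl⟩
  rcases hN.lt_or_eq with h | h
  · rw [word_eq_zero hK _ l κ hκ le_rfl h]
    exact zero_mem _
  · rw [word_eq_constantCoeff hK hκ l h]
    exact Submodule.smul_mem _ _ hκ

/-- A Whittaker vector in the module generated by a `z`-stable space of Whittaker vectors lies
in that space. -/
theorem IsWhittakerVector.mem_of_mem_filtAll (hφ : charVal φ (true, 2) ≠ 0)
    (hK : IsWhittakerSpace φ K) {v : V} (hv : IsWhittakerVector φ v) :
    ∀ n : ℕ, v ∈ filtAll K n → v ∈ K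
  | 0, h => filtAll_zero_le hK h
  | n + 1, h => hv.mem_of_mem_filtAll hφ hK n (hv.mem_filtAll_pred hφ hK (by exact_mod_cast h))

/-! ### The generated submodule and S(z)w -/

theorem z_smul_mem_filtAll (hK : IsWhittakerSpace φ K) {v : V} (hv : v ∈ filtAll K N) :
    ⁅z, v⁆ ∈ filtAll K N := by
  have : filtAll K N ≤ (filtAll K N).comap (LieModule.toEnd ℂ W22 V z) := by
    refine Submodule.span_le.mpr ?_
    rintro _ ⟨l, κ, hκ, hN, rfl⟩
    change ⁅z, word l κ⁆ ∈ filtAll K N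
    rw [lie_z_word]
    exact word_mem_filtAll (hK.z_mem κ hκ) hN
  exact this hv

/-- The `𝒲`-submodule generated by a `z`-stable space of Whittaker vectors. -/
def filtUnion (hK : IsWhittakerSpace φ K) : LieSubmodule ℂ W22 V where
  carrier := {v | ∃ n : ℕ, v ∈ filtAll K n}
  zero_mem' := ⟨0, zero_mem _⟩
  add_mem' := by
    rintro a b ⟨n, hn⟩ ⟨m, hm⟩
    exact ⟨max n m, add_mem (filtAll_mono (by exact_mod_cast le_max_left n m) hn)
      (filtAll_mono (by exact_mod_cast le_max_right n m) hm)⟩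
  smul_mem' := by
    rintro c a ⟨n, hn⟩
    exact ⟨n, Submodule.smul_mem _ _ hn⟩
  lie_mem := by
    rintro x v ⟨n, hn⟩
    have hgen (g : Idx) : ∃ k : ℕ, ⁅gen g, v⁆ ∈ filtAll K k :=
      ⟨(wt g + n).toNat, lie_mem_filtAll hn (Int.self_le_toNat _)⟩
    change ∃ k : ℕ, ⁅x, v⁆ ∈ filtAll K k
    have hx : x ∈ Submodule.span ℂ (Set.range basis) := by rw [basis.span_eq]; trivial
    refine Submodule.span_induction ?_ ?_ ?_ ?_ hx
    · rintro _ ⟨a | a | _, rfl⟩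
      · exact hgen (false, a)
      · exact hgen (true, a)
      · exact ⟨n, z_smul_mem_filtAll hK hn⟩
    · exact ⟨0, by rw [zero_lie]; exact zero_mem _⟩
    · rintro a b _ _ ⟨k, hk⟩ ⟨m, hm⟩
      refine ⟨max k m, ?_⟩
      rw [add_lie]
      exact add_mem (filtAll_mono (by exact_mod_cast le_max_left k m) hk)
        (filtAll_mono (by exact_mod_cast le_max_right k m) hm)
    · rintro c a _ ⟨k, hk⟩
      refine ⟨k, ?_⟩
      rw [smul_lie]
      exact Submodule.smul_mem _ _ hk

theorem envAction_lie {p : UniversalEnvelopingAlgebra ℂ W22} (hp : p ∈ Sz) (x : W22) (v : V) :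
    envAction V p ⁅x, v⁆ = ⁅x, envAction V p v⁆ := by
  induction hp using Algebra.adjoin_induction generalizing v with
  | mem p hp =>
    obtain rfl := Set.mem_singleton_iff.mp hp
    simpa [envAction] using lie_z_comm x v
  | algebraMap c => simp [Module.algebraMap_end_apply]
  | add p q _ _ hp hq => simp [hp, hq]
  | mul p q _ _ hp hq => simp [hp, hq]

/-- The space `S(z)w`. -/
def SzSpan (w : V) : Submodule ℂ V :=
  (Subalgebra.toSubmodule Sz).map ((LinearMap.applyₗ w).comp (envAction V).toLinearMap)

theorem mem_SzSpan {w v : V} : v ∈ SzSpan w ↔ ∃ p ∈ Sz, v = envAction V p w :=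
  ⟨fun ⟨p, hp, e⟩ => ⟨p, hp, e.symm⟩, fun ⟨p, hp, e⟩ => ⟨p, hp, e.symm⟩⟩

theorem isWhittakerSpace_SzSpan {w : V} (hw : IsWhittakerVector φ w) :
    IsWhittakerSpace φ (SzSpan w) where
  whittaker κ hκ x := by
    obtain ⟨p, hp, rfl⟩ := mem_SzSpan.mp hκ
    rw [← envAction_lie hp, hw x, map_smul]
  z_mem κ hκ := by
    obtain ⟨p, hp, rfl⟩ := mem_SzSpan.mp hκ
    refine mem_SzSpan.mpr ⟨UniversalEnvelopingAlgebra.ι ℂ z * p,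
      mul_mem (Algebra.subset_adjoin rfl) hp, ?_⟩
    simp [envAction]

end Modules

end WAlgebra22

end

theorem lemma5p3p1 {V : Type*} [AddCommGroup V] [Module ℂ V]
    [LieRingModule WAlgebra22.W22 V] [LieModule ℂ WAlgebra22.W22 V]
    (φ : LieAlgebra.LieCharacter ℂ WAlgebra22.Wplus) (w : V)
    (hw : WAlgebra22.IsCyclicWhittakerVector φ w)
    (hV : WAlgebra22.IsIndecomposable V) :
    {v : V | WAlgebra22.IsWhittakerVector φ v} =
      {v : V | ∃ p ∈ WAlgebra22.Sz, v = WAlgebra22.envAction V p w} := by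
  have hK := WAlgebra22.isWhittakerSpace_SzSpan hw.whittaker
  ext v
  refine ⟨fun hv => WAlgebra22.mem_SzSpan.mp ?_, fun hv =>
    hK.whittaker v (WAlgebra22.mem_SzSpan.mpr hv)⟩
  have hφ : WAlgebra22.charVal φ (true, 2) ≠ 0 := by
    rw [WAlgebra22.charVal, dif_pos two_pos]
    exact right_ne_zero_of_mul hw.nonsingular.2
  have hwK : w ∈ WAlgebra22.SzSpan w := WAlgebra22.mem_SzSpan.mpr ⟨1, one_mem _, by simp⟩
  have htop : WAlgebra22.filtUnion hK = ⊤ := by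
    rw [← top_le_iff, ← hw.generates, LieSubmodule.lieSpan_le, Set.singleton_subset_iff]
    exact ⟨0, WAlgebra22.word_mem_filtAll (l := []) hwK (by simp)⟩
  obtain ⟨n, hn⟩ : v ∈ WAlgebra22.filtUnion hK := htop ▸ LieSubmodule.mem_top v
  exact WAlgebra22.IsWhittakerVector.mem_of_mem_filtAll hφ hK hv n hn
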